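/- The following separation problem is (Turing-)decidable, uniformly in $n$ and $k$. INSTANCE: a natural number $n$ and a finite list of MV-terms $\tau_1,\dots,\tau_k$ in the variables $X_1,\dots,X_n$, that is, expressions built from $X_1,\dots,X_n$ and the constant $0$ by the connectives $\neg$ (unary) and $\oplus$ (binary). QUESTION: does the set $\{\hat\tau_1,\dots,\hat\tau_k\}$ separate the points of $[0,1]^n$, i.e., is there, for all $x\neq y$ in $[0,1]^n$, an index $i$ with $\hat\tau_i(x)\neq\hat\tau_i(y)$? Here $\hat\tau\colon[0,1]^n\to[0,1]$ is the McNaughton function defined by $\tau$: $\hat X_i$ is the $i$th coordinate function, $\hat 0=0$, $\widehat{\neg\sigma}=1-\hat\sigma$ and $\widehat{\sigma\oplus\rho}=\min(1,\hat\sigma+\hat\rho)$ pointwise. -/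

import Mathlib

/-- MV-terms over the set `V` of variables: built from the variables and the constant `0` by
finitely many applications of the connectives `¬` (`neg`) and `⊕` (`oplus`). -/
inductive MVTerm (V : Type) : Type where
  | zero : MVTerm V
  | var : V → MVTerm V
  | neg : MVTerm V → MVTerm V
  | oplus : MVTerm V → MVTerm V → MVTerm V

namespace MVTerm

/-- Replace every variable `v` by the variable `r v`. -/
def rename {V W : Type} (r : V → W) : MVTerm V → MVTerm W
  | zero => zero
  | var v => var (r v)
  | neg s => neg (rename r s)
  | oplus s t => oplus (rename r s) (rename r t)

/-- The truncated sum `min 1 (a + b)` of the standard MV-algebra `[0,1]`. -/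
noncomputable def truncAdd (a b : unitInterval) : unitInterval :=
  ⟨min 1 ((a : ℝ) + b), le_min zero_le_one (add_nonneg a.2.1 b.2.1), min_le_left _ _⟩

/-- The function `τ̂ : [0,1]^V → [0,1]` of an MV-term `τ`: a variable is interpreted as the
corresponding coordinate function, and the operations on functions are the pointwise operations
of the standard MV-algebra `[0,1]`, where `¬ a = 1 - a` and `a ⊕ b = min 1 (a + b)`.
With `V = Fin n` this is the McNaughton function of a term in `X₁, …, Xₙ`. -/
noncomputable def hat {V : Type} : MVTerm V → (V → unitInterval) → unitInterval
  | zero => fun _ => 0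
  | var v => fun x => x v
  | neg s => fun x => unitInterval.symm (hat s x)
  | oplus s t => fun x => truncAdd (hat s x) (hat t x)

/-- An explicit Gödel numbering of the MV-terms in the variables `X₁, X₂, …`
(`var i` is the variable `X_{i+1}`). -/
def code : MVTerm ℕ → ℕ
  | zero => 0
  | var i => 3 * i + 1
  | neg s => 3 * code s + 2
  | oplus s t => 3 * Nat.pair (code s) (code t) + 3

/-- The inverse of the Gödel numbering. -/
def ofCode : ℕ → MVTerm ℕ
  | 0 => zero
  | m + 1 =>
    have h : m / 3 < m + 1 := by omega
    have h1 : (m / 3).unpair.1 < m + 1 := lt_of_le_of_lt (Nat.unpair_left_le _) h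
    have h2 : (m / 3).unpair.2 < m + 1 := lt_of_le_of_lt (Nat.unpair_right_le _) h
    if m % 3 = 0 then var (m / 3)
    else if m % 3 = 1 then neg (ofCode (m / 3))
    else oplus (ofCode (m / 3).unpair.1) (ofCode (m / 3).unpair.2)

theorem ofCode_code (t : MVTerm ℕ) : ofCode (code t) = t := by
  induction t with
  | zero => simp [code, ofCode]
  | var i =>
    have h : 3 * i / 3 = i := by omega
    simp [code, ofCode, h]
  | neg s ih =>
    have h : (3 * code s + 1) / 3 = code s := by omega
    have h' : (3 * code s + 1) % 3 = 1 := by omega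
    simp [code, ofCode, h, h', ih]
  | oplus s t ihs iht =>
    have h : (3 * Nat.pair (code s) (code t) + 2) / 3 = Nat.pair (code s) (code t) := by omega
    have h' : (3 * Nat.pair (code s) (code t) + 2) % 3 = 2 := by omega
    simp [code, ofCode, h, h', ihs, iht]

theorem code_ofCode (m : ℕ) : code (ofCode m) = m := by
  induction m using Nat.strong_induction_on with
  | _ m ih =>
    cases m with
    | zero => simp [code, ofCode]
    | succ m =>
      have h : m / 3 < m + 1 := by omega
      have h1 : (m / 3).unpair.1 < m + 1 := lt_of_le_of_lt (Nat.unpair_left_le _) h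
      have h2 : (m / 3).unpair.2 < m + 1 := lt_of_le_of_lt (Nat.unpair_right_le _) h
      rw [ofCode]
      split_ifs with h0 h3
      · simp only [code]; omega
      · simp only [code, ih _ h]; omega
      · simp only [code, ih _ h1, ih _ h2, Nat.pair_unpair]; omega

/-- Terms are handed to algorithms through their Gödel numbers. -/
instance instDenumerable : Denumerable (MVTerm ℕ) :=
  Denumerable.mk' ⟨code, ofCode, ofCode_code, code_ofCode⟩

end MVTerm

/-!
Failure of separation is witnessed by a pair of distinct points `x, y ∈ [0,1]ⁿ` at which all the
given McNaughton functions agree. The proof shows that such a pair may be taken rational, with a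
common denominator bounded by an explicit function of the instance. Since the value of a term at a
rational point with denominator `d` is computed in the finite MV-chain `{0, …, d}`, the problem is
thereby reduced to a bounded search, which is even primitive recursive.

The bound rests on `exists_sameSigns`: for every nonnegative real point `z ∈ ℝᵐ` there is a
nonnegative integer point `w`, bounded in terms of `m` and `A`, such that every homogeneous linear
form with integer coefficients of absolute value at most `A` has the same sign at `z` and at `w`.
This is proved as in Fourier–Motzkin elimination: the signs of the forms in the first variable
depend on its position among finitely many thresholds, and the thresholds are compared by forms of
height `2 * A ^ 2` in the remaining variables, to which the induction hypothesis applies.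

The lemma is applied to `z = (1, x, y)`, giving `w = (d, X, Y)`. A McNaughton function is piecewise
linear with integer coefficients bounded by the size of the term, and both the choice of the piece
and the equality of two values are decided by signs of forms of bounded height
(`MVTerm.exists_intForm_eq`). Hence `X / d` and `Y / d` are again distinct points that are not separated,
and `MVTerm.separates_iff` follows.
-/

/-! ### Integer linear forms and points with the same signs -/

/-- The value at `z` of the homogeneous linear form with integer coefficients `c`. -/
def intForm {ι R : Type*} [Fintype ι] [CommRing R] (c : ι → ℤ) (z : ι → R) : R :=
  ∑ i, (c i : R) * z i

section intForm

variable {ι R : Type*} [Fintype ι] [CommRing R] (b c : ι → ℤ) (z : ι → R)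

theorem intForm_zero : intForm 0 z = 0 := by simp [intForm]

theorem intForm_add : intForm (b + c) z = intForm b z + intForm c z := by
  simp [intForm, add_mul, Finset.sum_add_distrib]

theorem intForm_neg : intForm (-c) z = -intForm c z := by simp [intForm]

theorem intForm_sub : intForm (b - c) z = intForm b z - intForm c z := by
  rw [sub_eq_add_neg, intForm_add, intForm_neg, sub_eq_add_neg]

theorem intForm_smul (k : ℤ) : intForm (k • c) z = k * intForm c z := by
  simp [intForm, Finset.mul_sum, mul_assoc]

theorem intForm_mul_right (r : R) : intForm c (fun i => r * z i) = r * intForm c z := by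
  simp only [intForm, Finset.mul_sum]
  exact Finset.sum_congr rfl fun i _ => by ring

theorem intForm_single [DecidableEq ι] (i : ι) : intForm (Pi.single i 1) z = z i := by
  simp [intForm, Pi.single_apply]

theorem intForm_succ {m : ℕ} (c : Fin (m + 1) → ℤ) (z : Fin (m + 1) → R) :
    intForm c z = c 0 * z 0 + intForm (Fin.tail c) (Fin.tail z) := by
  simp [intForm, Fin.sum_univ_succ, Fin.tail]

theorem abs_intForm_le {m A B : ℕ} {c z : Fin m → ℤ} (hc : ∀ i, |c i| ≤ A)
    (hz : ∀ i, |z i| ≤ B) : |intForm c z| ≤ m * A * B := by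
  calc |intForm c z| ≤ ∑ i, |(c i : ℤ) * z i| := Finset.abs_sum_le_sum_abs _ _
    _ ≤ ∑ _i : Fin m, (A : ℤ) * B := Finset.sum_le_sum fun i _ => by
        rw [abs_mul]
        exact mul_le_mul (hc i) (hz i) (abs_nonneg _) (by positivity)
    _ = m * A * B := by simp [mul_assoc]

end intForm

theorem abs_single_one_le {ι : Type*} [DecidableEq ι] {A : ℕ} (hA : 1 ≤ A) (i j : ι) :
    |(Pi.single i 1 : ι → ℤ) j| ≤ A := by
  rcases eq_or_ne j i with rfl | h
  · simpa using hA
  · simp [Pi.single_eq_of_ne h]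

/-- The integer point `w` has the same signs as the real point `z` up to height `A`: every
linear form with integer coefficients of absolute value at most `A` is nonnegative at `w` if and
only if it is nonnegative at `z`. -/
def SameSigns {ι : Type*} [Fintype ι] (A : ℕ) (z : ι → ℝ) (w : ι → ℤ) : Prop :=
  ∀ c : ι → ℤ, (∀ i, |c i| ≤ A) → (0 ≤ intForm c z ↔ 0 ≤ intForm c w)

namespace SameSigns

variable {ι : Type*} [Fintype ι] {A : ℕ} {z : ι → ℝ} {w : ι → ℤ} {c : ι → ℤ}

theorem pos_iff (h : SameSigns A z w) (hc : ∀ i, |c i| ≤ A) :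
    0 < intForm c z ↔ 0 < intForm c w := by
  have := h (-c) (by simpa using hc)
  rw [intForm_neg, intForm_neg, neg_nonneg, neg_nonneg] at this
  rw [← not_le, ← not_le, this]

theorem eq_zero_iff (h : SameSigns A z w) (hc : ∀ i, |c i| ≤ A) :
    intForm c z = 0 ↔ intForm c w = 0 := by
  have h1 := h c hc
  have h2 := h.pos_iff hc
  constructor
  · intro e
    rw [e] at h1 h2
    exact le_antisymm (not_lt.1 fun h' => lt_irrefl _ (h2.2 h')) (h1.1 le_rfl)
  · intro e
    rw [e] at h1 h2
    exact le_antisymm (not_lt.1 fun h' => lt_irrefl _ (h2.1 h')) (h1.2 le_rfl)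

end SameSigns

/-- The inductive step of `exists_sameSigns`: a point with the signs of the last coordinates of
`z` is scaled and completed by a first coordinate. The forms with positive leading coefficient
that are nonnegative at `z` bound the first coordinate of `z` from below; the new coordinate is
the largest of these bounds, plus a small amount if that bound is strict. -/
theorem SameSigns.exists_cons {m A B : ℕ} (hA : 1 ≤ A) {z : Fin (m + 1) → ℝ} (hz : 0 ≤ z 0)
    {w' : Fin m → ℤ} (hw : SameSigns (2 * A ^ 2) (Fin.tail z) w') (hB : ∀ i, |w' i| ≤ B) :
    ∃ w : Fin (m + 1) → ℤ, SameSigns A z w ∧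
      ∀ i, w i ≤ ((2 * A ^ 2 * (m * A * B) + 2 * A ^ 3 * B + 1 : ℕ) : ℤ) := by
  have hA' : (1 : ℤ) ≤ A := by exact_mod_cast hA
  let S : Set (Fin (m + 1) → ℤ) := {c | (∀ i, |c i| ≤ A) ∧ 0 < c 0 ∧ 0 ≤ intForm c z}
  have hfin : S.Finite := by
    refine (Set.finite_Icc (fun _ => -(A : ℤ)) (fun _ => (A : ℤ))).subset fun c hc => ?_
    exact ⟨fun i => (abs_le.1 (hc.1 i)).1, fun i => (abs_le.1 (hc.1 i)).2⟩
  have hne : S.Nonempty :=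
    ⟨Pi.single 0 1, abs_single_one_le hA 0, by simp, by rwa [intForm_single]⟩
  obtain ⟨c, ⟨hcA, hc0, hcz⟩, hmin⟩ :=
    Set.exists_min_image S (fun c => intForm c z / (c 0 : ℝ)) hfin hne
  have hcR : (0 : ℝ) < c 0 := by exact_mod_cast hc0
  have hcA0 : c 0 ≤ A := (abs_le.1 (hcA 0)).2
  -- After scaling by `2 * A ^ 2 * c 0`, a threshold of the form `e` exceeding that of `c` does so
  -- by at least `2 * A ^ 2 / e 0 > 1`, so that a strict bound leaves room for the summand `1`.
  set δ : ℤ := if intForm c z = 0 then 0 else 1 with hδ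
  let w : Fin (m + 1) → ℤ :=
    Fin.cons (-intForm (Fin.tail c) w' * (2 * A ^ 2) + δ) fun i => 2 * A ^ 2 * c 0 * w' i
  have hlead : ∀ e : Fin (m + 1) → ℤ, (∀ i, |e i| ≤ A) → 0 < e 0 →
      (0 ≤ intForm e z ↔ 0 ≤ intForm e w) ∧ (0 < intForm e z ↔ 0 < intForm e w) := by
    intro e heA he0
    have heR : (0 : ℝ) < e 0 := by exact_mod_cast he0
    have heA0 : e 0 ≤ A := (abs_le.1 (heA 0)).2
    -- eliminating the first variable between `c` and `e`
    set f : Fin m → ℤ := c 0 • Fin.tail e - e 0 • Fin.tail c with hf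
    have hfA : ∀ i, |f i| ≤ ((2 * A ^ 2 : ℕ) : ℤ) := by
      intro i
      have h1 : |c 0 * e i.succ| ≤ A * A := by
        rw [abs_mul]; exact mul_le_mul (hcA 0) (heA _) (abs_nonneg _) (by positivity)
      have h2 : |e 0 * c i.succ| ≤ A * A := by
        rw [abs_mul]; exact mul_le_mul (heA 0) (hcA _) (abs_nonneg _) (by positivity)
      have h3 : |f i| ≤ |c 0 * e i.succ| + |e 0 * c i.succ| := by
        simpa [hf, Fin.tail] using abs_sub (c 0 * e i.succ) (e 0 * c i.succ)
      push_cast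
      nlinarith
    have hfz : intForm f (Fin.tail z) = c 0 * intForm e z - e 0 * intForm c z := by
      rw [hf, intForm_sub, intForm_smul, intForm_smul, intForm_succ e, intForm_succ c]
      ring
    have hew : intForm e w = 2 * A ^ 2 * intForm f w' + δ * e 0 := by
      have ht : Fin.tail w = fun i => 2 * A ^ 2 * c 0 * w' i := Fin.tail_cons _ _
      have h0 : w 0 = -intForm (Fin.tail c) w' * (2 * A ^ 2) + δ := rfl
      rw [intForm_succ, ht, h0, intForm_mul_right, hf, intForm_sub, intForm_smul, intForm_smul]
      simp only [Int.cast_id]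
      ring
    have hK : (0 : ℤ) < 2 * A ^ 2 := by positivity
    have s1 := hw f hfA
    have s2 := hw.pos_iff hfA
    by_cases hg : intForm c z = 0
    · simp only [hg, if_true, mul_zero, sub_zero] at hδ hfz
      rw [hew, hδ, zero_mul, add_zero, mul_nonneg_iff_of_pos_left hK, mul_pos_iff_of_pos_left hK,
        ← s1, ← s2, hfz, mul_nonneg_iff_of_pos_left hcR, mul_pos_iff_of_pos_left hcR]
      exact ⟨Iff.rfl, Iff.rfl⟩
    · have hgpos : 0 < intForm c z := lt_of_le_of_ne hcz (Ne.symm hg)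
      simp only [hg, if_false] at hδ
      rw [hew, hδ, one_mul]
      rcases le_or_gt 0 (intForm e z) with hez | hez
      · have hm : intForm c z / (c 0 : ℝ) ≤ intForm e z / (e 0 : ℝ) := hmin e ⟨heA, he0, hez⟩
        rw [div_le_div_iff₀ hcR heR] at hm
        have h1 : 0 ≤ intForm f w' := s1.1 (by rw [hfz]; linarith)
        have h2 : 0 < intForm e z := by
          have : 0 < (c 0 : ℝ) * intForm e z := by
            have := mul_pos hgpos heR
            linarith
          exact (mul_pos_iff_of_pos_left hcR).1 this
        have h3 : 0 < 2 * (A : ℤ) ^ 2 * intForm f w' + e 0 := by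
          have := mul_nonneg hK.le h1
          linarith
        exact ⟨iff_of_true hez h3.le, iff_of_true h2 h3⟩
      · have h1 : intForm f w' < 0 := by
          refine not_le.1 fun h => not_lt.2 (s1.2 h) ?_
          rw [hfz]
          have := mul_pos_of_neg_of_neg hez (neg_lt_zero.2 hcR)
          have := mul_pos hgpos heR
          linarith
        have h3 : 2 * (A : ℤ) ^ 2 * intForm f w' + e 0 < 0 := by
          have : 2 * (A : ℤ) ^ 2 * intForm f w' ≤ 2 * (A : ℤ) ^ 2 * (-1) :=
            mul_le_mul_of_nonneg_left (by omega) hK.le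
          nlinarith
        exact ⟨iff_of_false (not_le.2 hez) (not_le.2 h3),
          iff_of_false (not_lt.2 hez.le) (not_lt.2 h3.le)⟩
  refine ⟨w, fun e heA => ?_, fun i => ?_⟩
  · rcases lt_trichotomy (e 0) 0 with h0 | h0 | h0
    · have := (hlead (-e) (by simpa using heA) (by simpa using h0)).2
      rw [intForm_neg, intForm_neg, neg_pos, neg_pos] at this
      rw [← not_lt, ← not_lt, this]
    · have ht : Fin.tail w = fun i => 2 * A ^ 2 * c 0 * w' i := Fin.tail_cons _ _
      rw [intForm_succ e z, intForm_succ e w, ht, h0, intForm_mul_right]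
      simp only [Int.cast_zero, zero_mul, zero_add]
      rw [mul_nonneg_iff_of_pos_left (by positivity)]
      refine hw _ fun i => (heA i.succ).trans ?_
      push_cast
      nlinarith
    · exact (hlead e heA h0).1
  · have hb := abs_intForm_le (c := Fin.tail c) (fun i => hcA i.succ) hB
    have hδ1 : δ ≤ 1 := by rw [hδ]; split_ifs <;> simp
    have hp1 : (0 : ℤ) ≤ 2 * A ^ 2 * (m * A * B) := by positivity
    have hp2 : (0 : ℤ) ≤ 2 * A ^ 3 * B := by positivity
    push_cast
    refine Fin.cases ?_ (fun j => ?_) i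
    · change -intForm (Fin.tail c) w' * (2 * A ^ 2) + δ ≤ _
      have h1 : -intForm (Fin.tail c) w' ≤ m * A * B := (neg_le_abs _).trans hb
      have h2 := mul_le_mul_of_nonneg_right h1 (show (0 : ℤ) ≤ 2 * A ^ 2 by positivity)
      linarith
    · change 2 * (A : ℤ) ^ 2 * c 0 * w' j ≤ _
      have h1 : c 0 * w' j ≤ A * B :=
        (le_abs_self _).trans ((abs_mul _ _).trans_le
          (mul_le_mul (hcA 0) (hB j) (abs_nonneg _) (by positivity)))
      have h2 := mul_le_mul_of_nonneg_left h1 (show (0 : ℤ) ≤ 2 * A ^ 2 by positivity)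
      linarith

/-- Every nonnegative real point has the same signs, up to height `A`, as a nonnegative integer
point whose coordinates are bounded in terms of `A` and the number of variables. The height is
replaced by `2 * A ^ 2` at each elimination of a variable, so that it never exceeds
`(2 * A) ^ 2 ^ m`. -/
theorem exists_sameSigns {m : ℕ} : ∀ {A N T : ℕ}, 1 ≤ A → m ≤ N → (2 * A) ^ 2 ^ m ≤ T →
    ∀ z : Fin m → ℝ, (∀ i, 0 ≤ z i) → ∃ w : Fin m → ℤ, SameSigns A z w ∧
      (∀ i, 0 ≤ w i) ∧ ∀ i, w i ≤ (((4 * N * T ^ 3) ^ m : ℕ) : ℤ) := by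
  induction m with
  | zero =>
    intro A N T _ _ _ z _
    exact ⟨fun _ => 0, fun c _ => by simp [intForm], fun _ => le_rfl, fun i => i.elim0⟩
  | succ m ih =>
    intro A N T hA hN hT z hz
    obtain ⟨w', hw', h0, hB⟩ := ih (A := 2 * A ^ 2) (N := N) (T := T)
      (by nlinarith) (by omega)
      (by
        refine le_trans (le_of_eq ?_) hT
        rw [pow_succ' 2 m, pow_mul]
        congr 1
        ring)
      (Fin.tail z) (fun i => hz i.succ)
    obtain ⟨w, hw, hwB⟩ := hw'.exists_cons hA (hz 0) (B := (4 * N * T ^ 3) ^ m)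
      (fun i => by rw [abs_of_nonneg (h0 i)]; exact hB i)
    refine ⟨w, hw, fun i => ?_, fun i => (hwB i).trans ?_⟩
    · have := (hw (Pi.single i 1) (abs_single_one_le hA i)).1
      rw [intForm_single, intForm_single] at this
      exact this (hz i)
    · have hAT : A ≤ T := by
        refine le_trans ?_ hT
        calc A ≤ (2 * A) ^ 1 := by rw [pow_one]; omega
          _ ≤ (2 * A) ^ 2 ^ (m + 1) := Nat.pow_le_pow_right (by omega) Nat.one_le_two_pow
      have hT3 : A ^ 3 ≤ T ^ 3 := Nat.pow_le_pow_left hAT 3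
      have hT1 : 1 ≤ T ^ 3 := Nat.one_le_pow _ _ (by omega)
      set B := (4 * N * T ^ 3) ^ m with hBdef
      have hNT : 1 ≤ N * T ^ 3 := Nat.mul_pos (by omega) hT1
      have hB1 : 1 ≤ B := Nat.one_le_pow _ _ (by nlinarith)
      norm_cast
      have h1 : (m + 1) * A ^ 3 ≤ N * T ^ 3 := Nat.mul_le_mul hN hT3
      calc 2 * A ^ 2 * (m * A * B) + 2 * A ^ 3 * B + 1 = 2 * ((m + 1) * A ^ 3) * B + 1 := by ring
        _ ≤ 2 * (N * T ^ 3) * B + (N * T ^ 3) * B :=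
          Nat.add_le_add (Nat.mul_le_mul_right _ (Nat.mul_le_mul_left _ h1))
            (Nat.mul_pos hNT hB1)
        _ ≤ B * (4 * N * T ^ 3) := by nlinarith [Nat.zero_le (N * T ^ 3 * B)]
        _ = (4 * N * T ^ 3) ^ (m + 1) := (pow_succ _ _).symm

/-! ### MV-terms in the finite Łukasiewicz chains -/

namespace MVTerm

/-- The number of nodes of a term; it bounds the coefficients of the linear pieces of `hat t`. -/
def size {V : Type} : MVTerm V → ℕ
  | zero => 1
  | var _ => 1
  | neg s => size s + 1
  | oplus s t => size s + size t + 1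

/-- The value of a term in the finite MV-chain `{0, …, d}`, the isomorphic copy of
`{0, 1/d, …, 1}` obtained by multiplying with `d`. -/
def level {V : Type} (d : ℕ) (X : V → ℕ) : MVTerm V → ℕ
  | zero => 0
  | var v => X v
  | neg s => d - level d X s
  | oplus s t => min d (level d X s + level d X t)

/-- One more than the largest index of a variable of the term, and `0` if there is none. -/
def varBound : MVTerm ℕ → ℕ
  | zero => 0
  | var i => i + 1
  | neg s => varBound s
  | oplus s t => max (varBound s) (varBound t)

theorem size_rename {V W : Type} (r : V → W) (t : MVTerm V) : size (rename r t) = size t := by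
  induction t with
  | zero => rfl
  | var v => rfl
  | neg s ih => simp [rename, size, ih]
  | oplus s t ihs iht => simp [rename, size, ihs, iht]

theorem level_rename {V W : Type} (r : V → W) (d : ℕ) (X : W → ℕ) (t : MVTerm V) :
    level d X (rename r t) = level d (fun v => X (r v)) t := by
  induction t with
  | zero => rfl
  | var v => rfl
  | neg s ih => simp [rename, level, ih]
  | oplus s t ihs iht => simp [rename, level, ihs, iht]

theorem level_le {V : Type} {d : ℕ} {X : V → ℕ} (hX : ∀ v, X v ≤ d) (t : MVTerm V) :
    level d X t ≤ d := by
  cases t with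
  | zero => exact Nat.zero_le _
  | var v => exact hX v
  | neg s => exact Nat.sub_le _ _
  | oplus s t => exact min_le_left _ _

theorem exists_rename_val_iff {n : ℕ} (t : MVTerm ℕ) :
    (∃ s : MVTerm (Fin n), rename Fin.val s = t) ↔ varBound t ≤ n := by
  constructor
  · rintro ⟨s, rfl⟩
    induction s with
    | zero => exact Nat.zero_le _
    | var v => exact v.2
    | neg s ih => exact ih
    | oplus s t ihs iht => exact max_le ihs iht
  · induction t with
    | zero => exact fun _ => ⟨zero, rfl⟩
    | var i => exact fun h => ⟨var ⟨i, h⟩, rfl⟩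
    | neg s ih =>
      intro h
      obtain ⟨s, rfl⟩ := ih h
      exact ⟨neg s, rfl⟩
    | oplus s t ihs iht =>
      intro h
      obtain ⟨s, rfl⟩ := ihs ((le_max_left _ _).trans h)
      obtain ⟨t, rfl⟩ := iht ((le_max_right _ _).trans h)
      exact ⟨oplus s t, rfl⟩

/-- At a rational point with common denominator `d`, a McNaughton function is evaluated in the
chain `{0, …, d}`. -/
theorem hat_mul_eq_level {V : Type} {d : ℕ} {X : V → ℕ} {x : V → unitInterval}
    (hX : ∀ v, X v ≤ d) (hx : ∀ v, (x v : ℝ) * d = X v) (t : MVTerm V) :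
    (hat t x : ℝ) * d = level d X t := by
  induction t with
  | zero => simp [hat, level]
  | var v => exact hx v
  | neg s ih =>
    simp only [hat, level, unitInterval.coe_symm_eq]
    rw [Nat.cast_sub (level_le hX s), ← ih]
    ring
  | oplus s t ihs iht =>
    simp only [hat, level, truncAdd]
    rw [min_mul_of_nonneg _ _ (Nat.cast_nonneg d), add_mul, ihs, iht, one_mul]
    push_cast
    rfl

/-- The linear pieces of a McNaughton function: around a point, `hat t` is given by a linear form
with integer coefficients bounded by the size of `t`, and any integer point with the same signs
lies in the domain of the same piece. The coordinate `o` carries the common denominator. -/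
theorem exists_intForm_eq {ι V : Type} [Fintype ι] [DecidableEq ι] {A : ℕ} {z : ι → ℝ}
    {w : ι → ℤ} (hzw : SameSigns A z w) {o : ι} {r : V → ι} {x : V → unitInterval} {d : ℕ}
    {X : V → ℕ} (hzo : z o = 1) (hzr : ∀ v, z (r v) = x v) (hwo : w o = d)
    (hwr : ∀ v, w (r v) = X v) (hX : ∀ v, X v ≤ d) :
    ∀ t : MVTerm V, size t ≤ A → ∃ c : ι → ℤ, (∀ i, |c i| ≤ size t) ∧
      (hat t x : ℝ) = intForm c z ∧ (level d X t : ℤ) = intForm c w := by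
  intro t
  induction t with
  | zero =>
    intro _
    exact ⟨0, fun i => by simp, by simp [hat, intForm_zero], by simp [level, intForm_zero]⟩
  | var v =>
    intro _
    exact ⟨Pi.single (r v) 1, abs_single_one_le le_rfl _,
      by rw [intForm_single, hzr, hat], by rw [intForm_single, hwr, level]⟩
  | neg s ih =>
    intro hA
    simp only [size] at hA
    obtain ⟨c, hc, hcz, hcw⟩ := ih (by omega)
    refine ⟨Pi.single o 1 - c, fun i => ?_, ?_, ?_⟩
    · have h1 := abs_single_one_le le_rfl o i
      have h2 := abs_sub ((Pi.single o 1 : ι → ℤ) i) (c i)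
      have h3 := hc i
      simp only [Pi.sub_apply, size]
      push_cast at h1 ⊢
      linarith
    · rw [intForm_sub, intForm_single, hzo, ← hcz]
      simp [hat, unitInterval.coe_symm_eq]
    · rw [intForm_sub, intForm_single, hwo, ← hcw, level, Nat.cast_sub (level_le hX s)]
  | oplus s t ihs iht =>
    intro hA
    simp only [size] at hA
    obtain ⟨b, hb, hbz, hbw⟩ := ihs (by omega)
    obtain ⟨c, hc, hcz, hcw⟩ := iht (by omega)
    have hbc : ∀ i, |b i + c i| ≤ (size s : ℤ) + size t := fun i =>
      (abs_add_le _ _).trans (add_le_add (hb i) (hc i))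
    -- the sign of `1 - (b + c)` decides which branch of the truncated sum is active
    have hsign := hzw (Pi.single o 1 - (b + c)) fun i => by
      have h1 := abs_single_one_le le_rfl o i
      have h2 := abs_sub ((Pi.single o 1 : ι → ℤ) i) (b i + c i)
      have h3 := hbc i
      have h4 : ((size s + size t + 1 : ℕ) : ℤ) ≤ A := by exact_mod_cast hA
      simp only [Pi.sub_apply, Pi.add_apply]
      push_cast at h1 h4
      linarith
    rw [intForm_sub, intForm_sub, intForm_add, intForm_add, intForm_single, intForm_single,
      hzo, hwo, ← hbz, ← hcz, ← hbw, ← hcw, sub_nonneg, sub_nonneg] at hsign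
    by_cases h : (hat s x : ℝ) + hat t x ≤ 1
    · refine ⟨b + c, fun i => ?_, ?_, ?_⟩
      · have := hbc i
        simp only [Pi.add_apply, size]
        push_cast
        linarith
      · rw [intForm_add, ← hbz, ← hcz]
        exact min_eq_right h
      · rw [intForm_add, ← hbw, ← hcw, level]
        have := hsign.1 h
        rw [min_eq_right (by exact_mod_cast this)]
        push_cast
        rfl
    · refine ⟨Pi.single o 1, fun i => ?_, ?_, ?_⟩
      · exact abs_single_one_le (by simp [size]) _ _
      · rw [intForm_single, hzo]
        exact min_eq_left (not_le.1 h).le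
      · rw [intForm_single, hwo, level]
        have : ¬ (level d X s + level d X t ≤ d) := fun h' => h (hsign.2 (by exact_mod_cast h'))
        rw [min_eq_left (by omega)]

/-- A pair of distinct points of `[0,1]ⁿ` not separated by the terms `τ` can be replaced by a
pair of rational points with a bounded common denominator. -/
theorem exists_level_eq_of_hat_eq {n A : ℕ} {τ : List (MVTerm (Fin n))}
    (hA : ∀ t ∈ τ, 2 * size t ≤ A) (hA2 : 2 ≤ A) {x y : Fin n → unitInterval} (hxy : x ≠ y)
    (h : ∀ t ∈ τ, hat t x = hat t y) :
    ∃ w : Fin (n + n + 1) → ℕ,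
      (∀ i, w i ≤ (4 * (n + n + 1) * ((2 * A) ^ 2 ^ (n + n + 1)) ^ 3) ^ (n + n + 1)) ∧
      (∀ i : Fin n, w (i.castAdd n).succ ≤ w 0 ∧ w (i.natAdd n).succ ≤ w 0) ∧
      (∃ i : Fin n, w (i.castAdd n).succ ≠ w (i.natAdd n).succ) ∧
      ∀ t ∈ τ, level (w 0) (fun i => w (i.castAdd n).succ) t =
        level (w 0) (fun i => w (i.natAdd n).succ) t := by
  let z : Fin (n + n + 1) → ℝ := Fin.cons 1 (Fin.append (fun i => (x i : ℝ)) fun i => (y i : ℝ))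
  have hz0 : z 0 = 1 := rfl
  have hzx : ∀ i : Fin n, z (i.castAdd n).succ = x i := fun i =>
    Fin.append_left (fun i => (x i : ℝ)) (fun i => (y i : ℝ)) i
  have hzy : ∀ i : Fin n, z (i.natAdd n).succ = y i := fun i =>
    Fin.append_right (fun i => (x i : ℝ)) (fun i => (y i : ℝ)) i
  have hz01 : ∀ j : Fin (n + n), 0 ≤ z j.succ ∧ z j.succ ≤ 1 := by
    intro j
    refine Fin.addCases (fun i => ?_) (fun i => ?_) j
    · rw [hzx]; exact (x i).2
    · rw [hzy]; exact (y i).2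
  obtain ⟨w', hw', hpos, hbd⟩ := exists_sameSigns (A := A) (by omega) le_rfl le_rfl z
    (Fin.cases (by simp [hz0]) fun j => (hz01 j).1)
  lift w' to Fin (n + n + 1) → ℕ using hpos with w
  -- the forms comparing two coordinates are within the height `A`
  have hdiff : ∀ i j k : Fin (n + n + 1),
      |(Pi.single i 1 - Pi.single j 1 : Fin (n + n + 1) → ℤ) k| ≤ (A : ℤ) := by
    intro i j k
    have h1 := abs_single_one_le le_rfl i k
    have h2 := abs_single_one_le le_rfl j k
    have h3 := abs_sub ((Pi.single i 1 : Fin (n + n + 1) → ℤ) k)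
      ((Pi.single j 1 : Fin (n + n + 1) → ℤ) k)
    have h4 : ((2 : ℕ) : ℤ) ≤ A := by exact_mod_cast hA2
    simp only [Pi.sub_apply]
    push_cast at h1 h2 h4
    linarith
  have hle : ∀ j : Fin (n + n), w j.succ ≤ w 0 := by
    intro j
    have := (hw' _ (hdiff 0 j.succ)).1
    simp only [intForm_sub, intForm_single, sub_nonneg, hz0] at this
    exact_mod_cast this (hz01 j).2
  refine ⟨w, fun i => by exact_mod_cast hbd i, fun i => ⟨hle _, hle _⟩, ?_, ?_⟩
  · obtain ⟨i, hi⟩ := Function.ne_iff.1 hxy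
    refine ⟨i, fun he => hi (Subtype.ext ?_)⟩
    have := (hw'.eq_zero_iff (hdiff (i.castAdd n).succ (i.natAdd n).succ)).2
    simp only [intForm_sub, intForm_single, hzx, hzy, he, sub_self, forall_const] at this
    exact sub_eq_zero.1 this
  · intro t ht
    have htA := hA t ht
    obtain ⟨b, hb, hbz, hbw⟩ := exists_intForm_eq hw' (o := 0) (r := fun i => (i.castAdd n).succ)
      (X := fun i => w (i.castAdd n).succ) hz0 hzx rfl (fun _ => rfl) (fun i => hle _) t (by omega)
    obtain ⟨c, hc, hcz, hcw⟩ := exists_intForm_eq hw' (o := 0) (r := fun i => (i.natAdd n).succ)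
      (X := fun i => w (i.natAdd n).succ) hz0 hzy rfl (fun _ => rfl) (fun i => hle _) t (by omega)
    have := (hw'.eq_zero_iff (c := b - c) fun i => by
      have h1 := abs_sub (b i) (c i)
      have h2 := hb i
      have h3 := hc i
      have h4 : ((2 * size t : ℕ) : ℤ) ≤ A := by exact_mod_cast htA
      simp only [Pi.sub_apply]
      push_cast at h4
      linarith).1
    rw [intForm_sub, intForm_sub, ← hbz, ← hcz, ← hbw, ← hcw, h t ht, sub_self] at this
    have := sub_eq_zero.1 (this rfl)
    exact_mod_cast this

/-- A failure of separation in a finite chain is a failure of separation in `[0,1]ⁿ`. -/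
theorem exists_hat_eq_of_level_eq {n d : ℕ} {τ : List (MVTerm (Fin n))} {X Y : Fin n → ℕ}
    (hX : ∀ i, X i ≤ d) (hY : ∀ i, Y i ≤ d) (hXY : X ≠ Y)
    (h : ∀ t ∈ τ, level d X t = level d Y t) :
    ∃ x y : Fin n → unitInterval, x ≠ y ∧ ∀ t ∈ τ, hat t x = hat t y := by
  obtain ⟨i, hi⟩ := Function.ne_iff.1 hXY
  have hd : (0 : ℝ) < d := by
    have h1 := hX i
    have h2 := hY i
    exact_mod_cast (show 0 < d by omega)
  let scale (X : Fin n → ℕ) (hX : ∀ i, X i ≤ d) : Fin n → unitInterval := fun i =>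
    ⟨X i / d, by positivity, (div_le_one hd).2 (by exact_mod_cast hX i)⟩
  have hscale : ∀ X hX v, (scale X hX v : ℝ) * d = X v := fun X hX v =>
    div_mul_cancel₀ _ hd.ne'
  refine ⟨scale X hX, scale Y hY, fun he => hi ?_, fun t ht => Subtype.ext ?_⟩
  · have h1 := hscale X hX i
    rw [he, hscale Y hY i] at h1
    exact_mod_cast h1.symm
  · apply mul_right_cancel₀ hd.ne'
    rw [hat_mul_eq_level hX (hscale X hX), hat_mul_eq_level hY (hscale Y hY), h t ht]

end MVTerm

/-! ### Primitive recursion on terms -/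

/-- Structural recursion on MV-terms is primitive recursive, as course-of-values recursion on
Gödel numbers. -/
theorem Primrec.mvTerm_rec {α σ : Type*} [Primcodable α] [Primcodable σ]
    {F : α → MVTerm ℕ → σ} {z : α → σ} {v : α → ℕ → σ} {g : α → σ → σ} {h : α → σ × σ → σ}
    (hz : Primrec z) (hv : Primrec₂ v) (hg : Primrec₂ g) (hh : Primrec₂ h)
    (Fzero : ∀ a, F a .zero = z a) (Fvar : ∀ a i, F a (.var i) = v a i)
    (Fneg : ∀ a s, F a (.neg s) = g a (F a s))
    (Foplus : ∀ a s t, F a (.oplus s t) = h a (F a s, F a t)) : Primrec₂ F := by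
  -- one step of the recursion: `m + 1` is the number to be decoded, `l` the list of earlier values
  let step : α → List σ → ℕ → Option σ := fun a l m =>
    if m % 3 = 0 then some (v a (m / 3))
    else if m % 3 = 1 then l[m / 3]?.map (g a)
    else l[(m / 3).unpair.1]?.bind fun s => l[(m / 3).unpair.2]?.map fun t => h a (s, t)
  have hstep : Primrec fun p : (α × List σ) × ℕ => step p.1.1 p.1.2 p.2 := by
    have ha : Primrec fun p : (α × List σ) × ℕ => p.1.1 := .comp .fst .fst
    have hl : Primrec fun p : (α × List σ) × ℕ => p.1.2 := .comp .snd .fst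
    have hq : Primrec fun p : (α × List σ) × ℕ => p.2 / 3 := nat_div.comp .snd (.const 3)
    have hr : Primrec fun p : (α × List σ) × ℕ => p.2 % 3 := nat_mod.comp .snd (.const 3)
    have hu : Primrec fun p : (α × List σ) × ℕ => (p.2 / 3).unpair := unpair.comp hq
    refine .ite (Primrec.eq.comp hr (.const 0)) (option_some.comp (hv.comp ha hq))
      (.ite (Primrec.eq.comp hr (.const 1))
        (option_map (list_getElem?.comp hl hq) (hg.comp (ha.comp .fst) .snd).to₂)
        (option_bind (list_getElem?.comp hl (fst.comp hu)) ?_))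
    have hrest : Primrec fun p : ((α × List σ) × ℕ) × σ => p.1.1.2[(p.1.2 / 3).unpair.2]? :=
      list_getElem?.comp (hl.comp .fst) (snd.comp (hu.comp .fst))
    have ha' : Primrec fun p : (((α × List σ) × ℕ) × σ) × σ => p.1.1.1.1 :=
      ha.comp (.comp .fst .fst)
    have hop : Primrec₂ fun (p : ((α × List σ) × ℕ) × σ) t => h p.1.1.1 (p.2, t) :=
      hh.comp ha' (.pair (.comp .snd .fst) .snd)
    exact (option_map hrest hop).to₂
  have hcode : Primrec₂ fun (a : α) (m : ℕ) => F a (MVTerm.ofCode m) := by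
    refine nat_strong_rec _
      (g := fun a l => Nat.casesOn (motive := fun _ => Option σ) l.length (some (z a)) (step a l))
      (nat_casesOn (f := fun p : α × List σ => p.2.length) (g := fun p => some (z p.1))
        (h := fun p m => step p.1 p.2 m)
        (list_length.comp .snd) (option_some.comp (hz.comp .fst)) hstep) ?_
    intro a n
    cases n with
    | zero => simp [MVTerm.ofCode, Fzero]
    | succ m =>
      have h0 : m / 3 < m + 1 := by omega
      have h1 : (m / 3).unpair.1 < m + 1 := lt_of_le_of_lt (Nat.unpair_left_le _) h0
      have h2 : (m / 3).unpair.2 < m + 1 := lt_of_le_of_lt (Nat.unpair_right_le _) h0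
      simp only [List.length_map, List.length_range]
      rw [MVTerm.ofCode]
      dsimp only [step]
      split_ifs with c0 c1
      · rw [Fvar]
      · rw [Fneg]
        simp [h0]
      · rw [Foplus]
        simp [h1, h2]
  exact (hcode.comp .fst (Primrec.encode.comp .snd)).of_eq fun p =>
    congrArg (F p.1) (MVTerm.ofCode_code p.2)

theorem Primrec.nat_pow : Primrec₂ ((· ^ ·) : ℕ → ℕ → ℕ) :=
  Primrec₂.unpaired'.1 Nat.Primrec.pow

namespace MVTerm

theorem primrec_varBound : Primrec varBound := by
  have : Primrec₂ fun (_ : Unit) t => varBound t :=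
    Primrec.mvTerm_rec (z := fun _ => 0) (v := fun _ i => i + 1) (g := fun _ s => s)
      (h := fun _ p => max p.1 p.2) (.const 0) (Primrec.succ.comp .snd) Primrec₂.right
      (Primrec.nat_max.comp (.comp .fst .snd) (.comp .snd .snd))
      (fun _ => rfl) (fun _ _ => rfl) (fun _ _ => rfl) fun _ _ _ => rfl
  exact this.comp (.const ()) .id

theorem primrec_size : Primrec (size : MVTerm ℕ → ℕ) := by
  have : Primrec₂ fun (_ : Unit) (t : MVTerm ℕ) => size t :=
    Primrec.mvTerm_rec (z := fun _ => 1) (v := fun _ _ => 1) (g := fun _ s => s + 1)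
      (h := fun _ p => p.1 + p.2 + 1) (.const 1) (Primrec₂.const 1) (Primrec.succ.comp .snd)
      (Primrec.succ.comp (Primrec.nat_add.comp (.comp .fst .snd) (.comp .snd .snd)))
      (fun _ => rfl) (fun _ _ => rfl) (fun _ _ => rfl) fun _ _ _ => rfl
  exact this.comp (.const ()) .id

theorem primrec_level {α : Type*} [Primcodable α] {d : α → ℕ} {X : α → ℕ → ℕ} (hd : Primrec d)
    (hX : Primrec₂ X) : Primrec₂ fun a t => level (d a) (X a) t :=
  Primrec.mvTerm_rec (z := fun _ => 0) (v := X) (g := fun a s => d a - s)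
    (h := fun a p => min (d a) (p.1 + p.2)) (.const 0) hX
    (Primrec.nat_sub.comp (hd.comp .fst) .snd)
    (Primrec.nat_min.comp (hd.comp .fst)
      (Primrec.nat_add.comp (.comp .fst .snd) (.comp .snd .snd)))
    (fun _ => rfl) (fun _ _ => rfl) (fun _ _ => rfl) fun _ _ _ => rfl

/-! ### The decision procedure -/

/-- The digit of index `i` in the base `b` expansion of `e`. -/
def digit (b e i : ℕ) : ℕ := e / b ^ i % b

theorem exists_digit_eq {m b : ℕ} (w : Fin m → ℕ) (hw : ∀ i, w i < b) :
    ∃ e < b ^ m, ∀ i : Fin m, digit b e i = w i := by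
  let f : Fin m → Fin b := fun i => ⟨w i, hw i⟩
  refine ⟨finFunctionFinEquiv f, (finFunctionFinEquiv f).2, fun i => ?_⟩
  exact congrArg Fin.val (congrFun (finFunctionFinEquiv.symm_apply_apply f) i)

/-- A height sufficient for the terms of the list. -/
def height (L : List (MVTerm ℕ)) : ℕ := L.foldr (fun t k => 2 * size t + k) 2

/-- The bound on the common denominator of the points to be searched. -/
def denomBound (p : ℕ × List (MVTerm ℕ)) : ℕ :=
  (4 * (p.1 + p.1 + 1) * ((2 * height p.2) ^ 2 ^ (p.1 + p.1 + 1)) ^ 3) ^ (p.1 + p.1 + 1)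

/-- The expansion of `e` in base `b` encodes a pair of points of `{0, …, d}ⁿ`: the digit of index
`0` is `d`, followed by the coordinates of the two points. This says that the two points are
distinct and take the same value in the chain `{0, …, d}` under all terms of `L`. -/
def IsWitness (n : ℕ) (L : List (MVTerm ℕ)) (b e : ℕ) : Prop :=
  (∀ i < n, digit b e (i + 1) ≤ digit b e 0 ∧ digit b e (n + i + 1) ≤ digit b e 0) ∧
    (∃ i < n, digit b e (i + 1) ≠ digit b e (n + i + 1)) ∧
    ∀ t ∈ L, level (digit b e 0) (fun i => digit b e (i + 1)) t =
      level (digit b e 0) (fun i => digit b e (n + i + 1)) t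

theorem le_height {L : List (MVTerm ℕ)} {t : MVTerm ℕ} (ht : t ∈ L) : 2 * size t ≤ height L := by
  induction L with
  | nil => simp at ht
  | cons s L ih =>
    rcases List.mem_cons.1 ht with rfl | ht
    · exact Nat.le_add_right _ _
    · exact (ih ht).trans (Nat.le_add_left _ _)

theorem two_le_height (L : List (MVTerm ℕ)) : 2 ≤ height L := by
  induction L with
  | nil => exact le_rfl
  | cons s L ih => exact ih.trans (Nat.le_add_left _ _)

theorem primrec_digit : Primrec fun q : ℕ × ℕ × ℕ => digit q.1 q.2.1 q.2.2 :=
  Primrec.nat_mod.comp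
    (Primrec.nat_div.comp (.comp .fst .snd) (Primrec.nat_pow.comp .fst (.comp .snd .snd))) .fst

theorem primrec_height : Primrec height :=
  Primrec.list_foldr .id (.const 2)
    (Primrec.nat_add.comp
      (Primrec.nat_mul.comp (.const 2) (primrec_size.comp (.comp .fst .snd)))
      (.comp .snd .snd)).to₂

theorem primrec_denomBound : Primrec denomBound := by
  have hm : Primrec fun p : ℕ × List (MVTerm ℕ) => p.1 + p.1 + 1 :=
    Primrec.succ.comp (Primrec.nat_add.comp .fst .fst)
  have hA : Primrec fun p : ℕ × List (MVTerm ℕ) => 2 * height p.2 :=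
    Primrec.nat_mul.comp (.const 2) (primrec_height.comp .snd)
  exact Primrec.nat_pow.comp
    (Primrec.nat_mul.comp (Primrec.nat_mul.comp (.const 4) hm)
      (Primrec.nat_pow.comp
        (Primrec.nat_pow.comp hA (Primrec.nat_pow.comp (.const 2) hm)) (.const 3))) hm

theorem primrecPred_isWitness :
    PrimrecPred fun q : (ℕ × List (MVTerm ℕ)) × ℕ × ℕ => IsWitness q.1.1 q.1.2 q.2.1 q.2.2 := by
  let P := (ℕ × List (MVTerm ℕ)) × ℕ × ℕ
  have hn : Primrec fun q : P => q.1.1 := .comp .fst .fst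
  have hL : Primrec fun q : P => q.1.2 := .comp .snd .fst
  have hd : Primrec fun q : P => digit q.2.1 q.2.2 0 :=
    primrec_digit.comp (.pair (.comp .fst .snd) (.pair (.comp .snd .snd) (.const 0)))
  have hX : Primrec₂ fun (q : P) (i : ℕ) => digit q.2.1 q.2.2 (i + 1) :=
    primrec_digit.comp (.pair (.comp .fst (.comp .snd .fst))
      (.pair (.comp .snd (.comp .snd .fst)) (Primrec.succ.comp .snd)))
  have hY : Primrec₂ fun (q : P) (i : ℕ) => digit q.2.1 q.2.2 (q.1.1 + i + 1) :=
    primrec_digit.comp (.pair (.comp .fst (.comp .snd .fst))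
      (.pair (.comp .snd (.comp .snd .fst))
        (Primrec.succ.comp (Primrec.nat_add.comp (hn.comp .fst) .snd))))
  have hd' : Primrec₂ fun (_ : ℕ) (q : P) => digit q.2.1 q.2.2 0 := hd.comp .snd
  have h1 : PrimrecRel fun (i : ℕ) (q : P) => digit q.2.1 q.2.2 (i + 1) ≤ digit q.2.1 q.2.2 0 ∧
      digit q.2.1 q.2.2 (q.1.1 + i + 1) ≤ digit q.2.1 q.2.2 0 :=
    PrimrecPred.and (Primrec.nat_le.comp₂ hX.swap hd') (Primrec.nat_le.comp₂ hY.swap hd')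
  have h2 : PrimrecRel fun (i : ℕ) (q : P) =>
      digit q.2.1 q.2.2 (i + 1) ≠ digit q.2.1 q.2.2 (q.1.1 + i + 1) :=
    PrimrecRel.not (Primrec.eq.comp₂ hX.swap hY.swap)
  have h3 : PrimrecRel fun (t : MVTerm ℕ) (q : P) =>
      level (digit q.2.1 q.2.2 0) (fun i => digit q.2.1 q.2.2 (i + 1)) t =
        level (digit q.2.1 q.2.2 0) (fun i => digit q.2.1 q.2.2 (q.1.1 + i + 1)) t :=
    Primrec.eq.comp₂ (primrec_level hd hX).swap (primrec_level hd hY).swap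
  have h1' := h1.forall_mem_list.comp (Primrec.list_range.comp hn) .id
  have h2' := h2.exists_mem_list.comp (Primrec.list_range.comp hn) .id
  have h3' := h3.forall_mem_list.comp hL .id
  exact (h1'.and (h2'.and h3')).of_eq fun q => by simp [IsWitness]

/-- The separation problem is equivalent to a bounded search in finite chains. -/
theorem separates_iff (p : ℕ × List (MVTerm ℕ)) :
    (∃ τ : List (MVTerm (Fin p.1)), p.2 = τ.map (rename Fin.val) ∧
      Set.SeparatesPoints {f : (Fin p.1 → unitInterval) → unitInterval | ∃ t ∈ τ, f = hat t}) ↔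
    (∀ t ∈ p.2, varBound t ≤ p.1) ∧
      ¬ ∃ e < (denomBound p + 1) ^ (p.1 + p.1 + 1), IsWitness p.1 p.2 (denomBound p + 1) e := by
  obtain ⟨n, L⟩ := p
  dsimp only
  constructor
  · rintro ⟨τ, rfl, hsep⟩
    refine ⟨fun t ht => ?_, ?_⟩
    · obtain ⟨s, -, rfl⟩ := List.mem_map.1 ht
      exact (exists_rename_val_iff _).1 ⟨s, rfl⟩
    · rintro ⟨e, -, hle, ⟨i, hi, hne⟩, heq⟩
      obtain ⟨x, y, hxy, h⟩ := exists_hat_eq_of_level_eq (τ := τ)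
        (fun i : Fin n => (hle i i.2).1) (fun i : Fin n => (hle i i.2).2)
        (fun he => hne (congrFun he ⟨i, hi⟩)) fun t ht => by
          have := heq _ (List.mem_map_of_mem ht)
          rwa [level_rename, level_rename] at this
      obtain ⟨f, ⟨t, ht, rfl⟩, hf⟩ := hsep hxy
      exact hf (h t ht)
  · rintro ⟨hvar, hno⟩
    obtain ⟨τ, rfl⟩ : ∃ τ : List (MVTerm (Fin n)), L = τ.map (rename Fin.val) := by
      obtain ⟨τ, hτ⟩ : L ∈ Set.range (List.map (rename (Fin.val (n := n)))) := by
        rw [Set.range_list_map]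
        exact fun t ht => (exists_rename_val_iff t).2 (hvar t ht)
      exact ⟨τ, hτ.symm⟩
    refine ⟨τ, rfl, fun x y hxy => ?_⟩
    by_contra hcon
    have h : ∀ t ∈ τ, hat t x = hat t y := fun t ht =>
      not_not.1 fun hne => hcon ⟨hat t, ⟨t, ht, rfl⟩, hne⟩
    obtain ⟨w, hwB, hle, ⟨i, hi⟩, heq⟩ := exists_level_eq_of_hat_eq
      (A := height (τ.map (rename Fin.val)))
      (fun t ht => by
        rw [← size_rename Fin.val t]
        exact le_height (List.mem_map_of_mem ht)) (two_le_height _) hxy h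
    obtain ⟨e, he, hdig⟩ := exists_digit_eq w fun i => Nat.lt_succ_of_le (hwB i)
    refine hno ⟨e, he, ?_⟩
    have h0 := hdig 0
    have hX : ∀ i : Fin n, _ = w (i.castAdd n).succ := fun i => hdig (i.castAdd n).succ
    have hY : ∀ i : Fin n, _ = w (i.natAdd n).succ := fun i => hdig (i.natAdd n).succ
    simp only [Fin.val_zero, Fin.val_succ, Fin.val_castAdd, Fin.val_natAdd] at h0 hX hY
    refine ⟨fun i hi => ?_, ⟨i, i.2, ?_⟩, fun t ht => ?_⟩
    · have h1 := hX ⟨i, hi⟩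
      have h2 := hY ⟨i, hi⟩
      have h3 := hle ⟨i, hi⟩
      rw [← h0, ← h1, ← h2] at h3
      exact h3
    · have := hi
      rw [← hX, ← hY] at this
      exact this
    · obtain ⟨s, hs, rfl⟩ := List.mem_map.1 ht
      have := heq s hs
      simp only [← h0, ← hX, ← hY] at this
      rw [level_rename, level_rename]
      exact this

end MVTerm
/-- The separation problem is decidable: an input is a number `n` together with a finite list of
MV-terms, and the yes-instances are those where the list consists of MV-terms `τ₁, …, τₖ` in the
variables `X₁, …, Xₙ` (that is, `var i` with `i < n`) such that `τ̂₁, …, τ̂ₖ` separate the points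
of `[0,1]ⁿ`. -/
theorem mainTheorem4 :
    ComputablePred fun p : ℕ × List (MVTerm ℕ) =>
      ∃ τ : List (MVTerm (Fin p.1)),
        p.2 = τ.map (MVTerm.rename Fin.val) ∧
          Set.SeparatesPoints {f : (Fin p.1 → unitInterval) → unitInterval |
            ∃ t ∈ τ, f = MVTerm.hat t} := by

  have hbase : Primrec fun p : ℕ × List (MVTerm ℕ) => MVTerm.denomBound p + 1 :=
    Primrec.succ.comp MVTerm.primrec_denomBound
  have hvar : PrimrecRel fun (t : MVTerm ℕ) (p : ℕ × List (MVTerm ℕ)) => t.varBound ≤ p.1 :=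
    Primrec.nat_le.comp₂ (MVTerm.primrec_varBound.comp .fst) (Primrec.fst.comp .snd)
  have hwit : PrimrecRel fun (e : ℕ) (p : ℕ × List (MVTerm ℕ)) =>
      MVTerm.IsWitness p.1 p.2 (MVTerm.denomBound p + 1) e :=
    MVTerm.primrecPred_isWitness.comp (.pair .snd (.pair (hbase.comp .snd) .fst))
  have hsearch := hwit.exists_mem_list.comp
    (Primrec.list_range.comp (Primrec.nat_pow.comp hbase
      (Primrec.succ.comp (Primrec.nat_add.comp .fst .fst)))) .id
  have hdecide := (hvar.forall_mem_list.comp .snd .id).and hsearch.not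
  refine (hdecide.of_eq fun p => ?_).computablePred
  rw [MVTerm.separates_iff]
  simp
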